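/- Let $d\in\mathbb N$ and let $f:\mathbb R^d\to\mathbb R$ be differentiable, with a global minimizer $x^\ast$ and minimum value $f^\ast=f(x^\ast)$. Let $L>0$, $\tau\in(0,1]$, $\mu>0$, $\rho\ge 1$, and assume: (L-smooth) $f(x)-f(y)-\langle\nabla f(y),x-y\rangle\le\frac L2\|x-y\|^2$ for all $x,y\in\mathbb R^d$; (SQC$_{\tau,\mu}$) $f^\ast\ge f(x)+\frac1\tau\langle\nabla f(x),x^\ast-x\rangle+\frac\mu2\|x-x^\ast\|^2$ for all $x\in\mathbb R^d$; (SGC$_\rho$) there are a probability law $\mathcal P$ on a space $\Xi$ and a measurable map $(x,\xi)\mapsto\nabla f(x,\xi)\in\mathbb R^d$, with $\nabla f(x,\cdot)$ square-integrable, such that for $\xi\sim\mathcal P$ and all $x\in\mathbb R^d$, $\mathbb E[\nabla f(x,\xi)]=\nabla f(x)$ and $\mathbb E[\|\nabla f(x,\xi)\|^2]\le\rho\|\nabla f(x)\|^2$. Let $T_0=0$ and let $T_1,T_2,\dots$ be random times such that the increments $T_{i+1}-T_i$, $i\ge 0$, are i.i.d. exponential with parameter $1$; let $\xi_1,\xi_2,\dots$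 be i.i.d. with law $\mathcal P$, independent of $(T_i)_i$. Let $\varepsilon\in(0,1)$ satisfy $\varepsilon\ge(\mu/L)^{1/4}$ and set $$\eta'=\frac{(1-\varepsilon)\tau}{\rho}\sqrt{\frac1{2(2-\tau)}}\sqrt{\frac\mu L},\quad \eta=\frac1\rho\sqrt{\frac2{2-\tau}}\sqrt{\frac\mu L},\quad \gamma'=\frac1\rho\sqrt{\frac{2-\tau}{2\mu L}},\quad \gamma=\frac1{\rho L}.$$ Given a deterministic $x_0\in\mathbb R^d$, let $\tilde x_0=\tilde z_0=x_0$ and, for $k\ge 0$, with $\delta_k=T_{k+1}-T_k$, let $$\tilde y_k=\tilde x_k+\frac{\eta}{\eta+\eta'}\bigl(1-e^{-(\eta+\eta')\delta_k}\bigr)(\tilde z_k-\tilde x_k),\qquad \tilde x_{k+1}=\tilde y_k-\gamma\nabla f(\tilde y_k,\xi_{k+1}),$$ $$\tilde z_{k+1}=\tilde z_k+\eta'\,\frac{1-e^{-(\eta+\eta')\delta_k}}{\eta'+\eta e^{-(\eta+\eta')\delta_k}}(\tilde y_k-\tilde z_k)-\gamma'\nabla f(\tilde y_k,\xi_{k+1}).$$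 Then for every $k\in\mathbb N$ the random variable below is integrable and $$\mathbb E\Bigl[\exp\Bigl(\tfrac{(1-\varepsilon)\tau}{\rho}\sqrt{\tfrac2{2-\tau}}\sqrt{\tfrac\mu L}\;T_k\Bigr)\bigl(f(\tilde x_k)-f^\ast\bigr)\Bigr]\le\frac1\varepsilon\bigl(f(x_0)-f^\ast+\mu\|x_0-x^\ast\|^2\bigr).$$ Moreover, for $\tau=1$ and $\rho=1$ the rate $\frac{(1-\varepsilon)\tau}{\rho}\sqrt{\frac2{2-\tau}}\sqrt{\frac\mu L}$ in the exponent equals $\sqrt2\,(1-\varepsilon)$ times the previously known rate $\tau\sqrt{\mu/L}$. -/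

import Mathlib

open MeasureTheory ProbabilityTheory

/-- `L`-smoothness: `L > 0` and `f x - f y - ⟪∇f y, x - y⟫ ≤ (L/2) ‖x - y‖²` for all `x, y`. -/
structure LSmooth {d : ℕ} (f : EuclideanSpace ℝ (Fin d) → ℝ) (L : ℝ) : Prop where
  pos : 0 < L
  upper_bound : ∀ x y : EuclideanSpace ℝ (Fin d),
    f x - f y - inner ℝ (gradient f y) (x - y) ≤ L / 2 * ‖x - y‖ ^ 2

/-- `(τ, μ)`-strong quasar convexity with respect to the global minimizer `xstar`;
the minimum `f*` of `f` is `f xstar`. -/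
structure StronglyQuasarConvex {d : ℕ} (f : EuclideanSpace ℝ (Fin d) → ℝ)
    (xstar : EuclideanSpace ℝ (Fin d)) (τ μ : ℝ) : Prop where
  tau_pos : 0 < τ
  tau_le_one : τ ≤ 1
  mu_pos : 0 < μ
  isMin : ∀ x, f xstar ≤ f x
  ineq : ∀ x, f xstar ≥
    f x + 1 / τ * inner ℝ (gradient f x) (xstar - x) + μ / 2 * ‖x - xstar‖ ^ 2

/-- `g x ξ`, with `ξ` of law `P`, is an unbiased square-integrable estimator of `∇f x` satisfying
the strong growth condition with constant `ρ ≥ 1`. -/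
structure StrongGrowth {d : ℕ} {Ξ : Type*} [MeasurableSpace Ξ]
    (f : EuclideanSpace ℝ (Fin d) → ℝ) (P : Measure Ξ)
    (g : EuclideanSpace ℝ (Fin d) → Ξ → EuclideanSpace ℝ (Fin d)) (ρ : ℝ) : Prop where
  one_le_rho : 1 ≤ ρ
  measurable : Measurable (fun p : EuclideanSpace ℝ (Fin d) × Ξ => g p.1 p.2)
  memLp : ∀ x, MemLp (g x) 2 P
  unbiased : ∀ x, ∫ ξ, g x ξ ∂P = gradient f x
  growth : ∀ x, ∫ ξ, ‖g x ξ‖ ^ 2 ∂P ≤ ρ * ‖gradient f x‖ ^ 2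

/-- The randomness driving the algorithm: `T 0 = 0`, the increments `T (i+1) - T i` are i.i.d.
exponential of parameter `1`, the samples `ξ 1, ξ 2, …` are i.i.d. of law `P`, and the two
sequences are independent of each other. (The value `ξ 0` is never used.) -/
structure IsDriving {Ω Ξ : Type*} [MeasurableSpace Ω] [MeasurableSpace Ξ] (Q : Measure Ω)
    (P : Measure Ξ) (T : ℕ → Ω → ℝ) (ξ : ℕ → Ω → Ξ) : Prop where
  measurable_time : ∀ i, Measurable (T i)
  measurable_sample : ∀ i, Measurable (ξ (i + 1))
  time_zero : ∀ ω, T 0 ω = 0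
  law_increment : ∀ i, Q.map (fun ω => T (i + 1) ω - T i ω) = expMeasure 1
  law_sample : ∀ i, Q.map (ξ (i + 1)) = P
  indep_increment : iIndepFun (fun (i : ℕ) (ω : Ω) => T (i + 1) ω - T i ω) Q
  indep_sample : iIndepFun (fun (i : ℕ) (ω : Ω) => ξ (i + 1) ω) Q
  indep : IndepFun (fun (ω : Ω) (i : ℕ) => T (i + 1) ω - T i ω)
    (fun (ω : Ω) (i : ℕ) => ξ (i + 1) ω) Q

noncomputable section

/-- The extrapolated point `ỹ` computed from `(x̃, z̃)` and the elapsed time `δ`. -/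
def cnaMid {d : ℕ} (η η' δ : ℝ) (x z : EuclideanSpace ℝ (Fin d)) : EuclideanSpace ℝ (Fin d) :=
  (η / (η + η') * (1 - Real.exp (-(η + η') * δ))) • (z - x) + x

/-- One step `(x̃, z̃) ↦ (x̃₊, z̃₊)` of the continuized Nesterov algorithm with elapsed time `δ`
and sample `s`. -/
def cnaStep {d : ℕ} {Ξ : Type*} (g : EuclideanSpace ℝ (Fin d) → Ξ → EuclideanSpace ℝ (Fin d))
    (η η' γ γ' δ : ℝ) (s : Ξ) (p : EuclideanSpace ℝ (Fin d) × EuclideanSpace ℝ (Fin d)) :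
    EuclideanSpace ℝ (Fin d) × EuclideanSpace ℝ (Fin d) :=
  (cnaMid η η' δ p.1 p.2 - γ • g (cnaMid η η' δ p.1 p.2) s,
    p.2 + (η' * ((1 - Real.exp (-(η + η') * δ)) / (η' + η * Real.exp (-(η + η') * δ)))) •
        (cnaMid η η' δ p.1 p.2 - p.2)
      - γ' • g (cnaMid η η' δ p.1 p.2) s)

/-- The iterates `(x̃ₖ, z̃ₖ)` of the continuized Nesterov algorithm started at `x̃₀ = z̃₀ = x₀`, for
the realized times `t` and samples `s`; step `k → k+1` uses `t (k+1) - t k` and `s (k+1)`. -/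
def cnaIter {d : ℕ} {Ξ : Type*} (g : EuclideanSpace ℝ (Fin d) → Ξ → EuclideanSpace ℝ (Fin d))
    (η η' γ γ' : ℝ) (x₀ : EuclideanSpace ℝ (Fin d)) (t : ℕ → ℝ) (s : ℕ → Ξ) :
    ℕ → EuclideanSpace ℝ (Fin d) × EuclideanSpace ℝ (Fin d)
  | 0 => (x₀, x₀)
  | k + 1 => cnaStep g η η' γ γ' (t (k + 1) - t k) (s (k + 1)) (cnaIter g η η' γ γ' x₀ t s k)

/-- The exponential rate `((1-ε) τ / ρ) √(2/(2-τ)) √(μ/L)`. -/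
def cnaRate (τ μ L ρ ε : ℝ) : ℝ :=
  (1 - ε) * τ / ρ * √(2 / (2 - τ)) * √(μ / L)

end

/-! Let `(x, z)` follow the linear flow `x' = η (z - x)`, `z' = η' (x - z)` between the points of a
Poisson process of rate 1, with a stochastic gradient jump at each point. The iterates are this
process right after its jumps (`cnaStep_eq_flow`). Take `V = f x - f* + b ‖z - x*‖² - c ‖x - x*‖²`.
The drift of `V` plus the mean change at a jump is at most `-2 η' V` (`lintegral_lyapunov_jump_le`),
so the expectation of `exp (2 η' T k) * V` does not increase with `k`, and `2 η'` is the announced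
rate.

The negative term is what improves the rate: when `c η = b η'`, the `‖x - z‖²` terms of the drift
cancel and the contraction of `‖z - x*‖²` doubles from `η'` to `2 η'`. The price is the sign of `V`.
Strong quasar convexity gives quadratic growth with constant `τ μ / (2 (2 - τ))`; taking `c` equal
to `1 - ε` times this constant leaves `V ≥ ε (f x - f*)`, which is where the factor `1 / ε` comes
from.

Expectations are handled as lower Lebesgue integrals of nonnegative quantities, so integrability is
only derived at the end, from the finite bound. -/

/-! ### Quadratic growth. -/

lemma hasDerivAt_comp_gradient {d : ℕ} {f : EuclideanSpace ℝ (Fin d) → ℝ}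
    (hf : Differentiable ℝ f) {X : ℝ → EuclideanSpace ℝ (Fin d)} {X' : EuclideanSpace ℝ (Fin d)}
    {t : ℝ} (hX : HasDerivAt X X' t) :
    HasDerivAt (fun s => f (X s)) (inner ℝ (gradient f (X t)) X') t := by
  exact (hf (X t)).hasGradientAt.hasFDerivAt.comp_hasDerivAt t hX

/-- Strong quasar convexity implies quadratic growth around the minimizer. -/
lemma StronglyQuasarConvex.quadratic_growth {d : ℕ} {f : EuclideanSpace ℝ (Fin d) → ℝ}
    {xstar : EuclideanSpace ℝ (Fin d)} {τ μ : ℝ} (h : StronglyQuasarConvex f xstar τ μ)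
    (hf : Differentiable ℝ f) (x : EuclideanSpace ℝ (Fin d)) :
    τ * μ / (2 * (2 - τ)) * ‖x - xstar‖ ^ 2 ≤ f x - f xstar := by
  have hτ := h.tau_pos
  have hτ1 := h.tau_le_one
  have hμ := h.mu_pos
  have h2τ : (0 : ℝ) < 2 - τ := by linarith
  set v := x - xstar with hv
  set C : ℝ := τ * μ / (2 * (2 - τ)) * ‖v‖ ^ 2 with hC
  have hC0 : 0 ≤ C := by positivity
  set φ : ℝ → ℝ := fun s => f (xstar + s • v) - f xstar with hφ
  have hφ0 : ∀ s, 0 ≤ φ s := fun s => sub_nonneg.2 (h.isMin _)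
  set φ' : ℝ → ℝ := fun s => inner ℝ (gradient f (xstar + s • v)) v with hφ'
  have hd : ∀ s, HasDerivAt φ (φ' s) s := by
    intro s
    have h1 : HasDerivAt (fun s : ℝ => xstar + s • v) v s := by
      simpa using ((hasDerivAt_id s).smul_const v).const_add xstar
    exact (hasDerivAt_comp_gradient hf h1).sub_const _
  -- Strong quasar convexity on the ray from `xstar` is a differential inequality of Euler type,
  -- with integrating factor `s ^ (-τ)`; `C s ^ 2` is the solution of the equality case.
  have hsq : ∀ s, τ * φ s + τ * μ / 2 * s ^ 2 * ‖v‖ ^ 2 ≤ s * φ' s := by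
    intro s
    have h1 := h.ineq (xstar + s • v)
    have e1 : xstar - (xstar + s • v) = (-s) • v := by simp
    have e2 : xstar + s • v - xstar = s • v := by simp
    rw [e1, e2, inner_smul_right, norm_smul, mul_pow, Real.norm_eq_abs, sq_abs] at h1
    change f xstar ≥ f (xstar + s • v) + 1 / τ * (-s * φ' s) + μ / 2 * (s ^ 2 * ‖v‖ ^ 2) at h1
    have h2 : φ s + μ / 2 * (s ^ 2 * ‖v‖ ^ 2) ≤ s * φ' s / τ := by
      have : 1 / τ * (-s * φ' s) = -(s * φ' s / τ) := by ring
      simp only [hφ]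
      linarith
    rw [le_div_iff₀ hτ] at h2
    linarith
  set ψ : ℝ → ℝ := fun s => s ^ (-τ) * φ s - C * s ^ (2 - τ) with hψ
  have hψd : ∀ s, 0 < s → HasDerivAt ψ
      (-τ * s ^ (-τ - 1) * φ s + s ^ (-τ) * φ' s - C * ((2 - τ) * s ^ (2 - τ - 1))) s := by
    intro s hs
    exact ((Real.hasDerivAt_rpow_const (Or.inl hs.ne')).mul (hd s)).sub
      ((Real.hasDerivAt_rpow_const (Or.inl hs.ne')).const_mul C)
  have hmono : MonotoneOn ψ (Set.Ioi 0) := by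
    refine monotoneOn_of_deriv_nonneg (convex_Ioi 0)
      (fun s hs => (hψd s hs).continuousAt.continuousWithinAt)
      (fun s hs => (hψd s (by simpa using hs)).differentiableAt.differentiableWithinAt) ?_
    intro s hs
    have hs : 0 < s := by simpa using hs
    rw [(hψd s hs).deriv]
    have e1 : s ^ (-τ) = s ^ (-τ - 1) * s := by
      rw [← Real.rpow_add_one hs.ne']; congr 1; ring
    have e2 : s ^ (2 - τ - 1) = s ^ (-τ - 1) * s ^ 2 := by
      rw [← Real.rpow_natCast, ← Real.rpow_add hs]; congr 1; push_cast; ring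
    have e3 : C * (2 - τ) = τ * μ / 2 * ‖v‖ ^ 2 := by
      rw [hC]; field_simp
    have e4 : -τ * s ^ (-τ - 1) * φ s + s ^ (-τ) * φ' s - C * ((2 - τ) * s ^ (2 - τ - 1))
        = s ^ (-τ - 1) * (s * φ' s - (τ * φ s + τ * μ / 2 * s ^ 2 * ‖v‖ ^ 2)) := by
      rw [e1, e2]
      linear_combination (-(s ^ (-τ - 1) * s ^ 2)) * e3
    rw [e4]
    exact mul_nonneg (Real.rpow_nonneg hs.le _) (sub_nonneg.2 (hsq s))
  have hx : φ 1 = f x - f xstar := by simp [hφ, hv]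
  -- Compare `ψ s ≤ ψ 1`. Only the sign of `s ^ (-τ) * φ s` is used, so its limit at `0` is never
  -- needed.
  have key : ∀ s ∈ Set.Ioc (0 : ℝ) 1, C * (1 - s) ≤ f x - f xstar := by
    rintro s ⟨hs, hs1⟩
    have h1 := hmono (Set.mem_Ioi.2 hs) (Set.mem_Ioi.2 one_pos) hs1
    simp only [hψ, Real.one_rpow, one_mul, mul_one, hx] at h1
    have h2 : s ^ (2 - τ) ≤ s := by
      simpa using Real.rpow_le_rpow_of_exponent_ge hs hs1 (by linarith : (1 : ℝ) ≤ 2 - τ)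
    have h3 : 0 ≤ s ^ (-τ) * φ s := mul_nonneg (Real.rpow_nonneg hs.le _) (hφ0 s)
    nlinarith
  have hlim : Filter.Tendsto (fun s : ℝ => C * (1 - s)) (nhdsWithin 0 (Set.Ioi 0)) (nhds C) := by
    have : Filter.Tendsto (fun s : ℝ => C * (1 - s)) (nhds 0) (nhds (C * (1 - 0))) :=
      (Continuous.tendsto (by fun_prop) 0)
    simpa using this.mono_left nhdsWithin_le_nhds
  refine le_of_tendsto hlim ?_
  filter_upwards [Ioc_mem_nhdsGT (zero_lt_one (α := ℝ))] with s hs using key s hs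

/-! ### Integrating out the newest increment and sample. -/

section Independence

variable {Ω α β γ δ : Type*} [MeasurableSpace Ω] [MeasurableSpace α] [MeasurableSpace β]
  [MeasurableSpace γ] [MeasurableSpace δ] {Q : Measure Ω} [IsProbabilityMeasure Q]

/-- If `A ⊥ B`, `C ⊥ D` and `(A, B) ⊥ (C, D)`, then `B` and `D` can be integrated out
independently of `(A, C)`. -/
lemma lintegral_of_indepFun_prod {A : Ω → α} {B : Ω → β} {C : Ω → γ} {D : Ω → δ}
    (hA : Measurable A) (hB : Measurable B) (hC : Measurable C) (hD : Measurable D)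
    (hAB : IndepFun A B Q) (hCD : IndepFun C D Q)
    (h : IndepFun (fun ω => (A ω, B ω)) (fun ω => (C ω, D ω)) Q)
    {F : (α × γ) × (β × δ) → ENNReal} (hF : Measurable F) :
    ∫⁻ ω, F ((A ω, C ω), (B ω, D ω)) ∂Q
      = ∫⁻ ω, ∫⁻ b, ∫⁻ e, F ((A ω, C ω), (b, e)) ∂(Q.map D) ∂(Q.map B) ∂Q := by
  have := Measure.isProbabilityMeasure_map (μ := Q) hA.aemeasurable
  have := Measure.isProbabilityMeasure_map (μ := Q) hB.aemeasurable
  have := Measure.isProbabilityMeasure_map (μ := Q) hC.aemeasurable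
  have := Measure.isProbabilityMeasure_map (μ := Q) hD.aemeasurable
  have hAC : IndepFun A C Q := h.comp measurable_fst measurable_fst
  have mAB := (indepFun_iff_map_prod_eq_prod_map_map hA.aemeasurable hB.aemeasurable).1 hAB
  have mCD := (indepFun_iff_map_prod_eq_prod_map_map hC.aemeasurable hD.aemeasurable).1 hCD
  have mAC := (indepFun_iff_map_prod_eq_prod_map_map hA.aemeasurable hC.aemeasurable).1 hAC
  have mm := (indepFun_iff_map_prod_eq_prod_map_map (hA.prodMk hB).aemeasurable
    (hC.prodMk hD).aemeasurable).1 h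
  rw [mAB, mCD] at mm
  have e1 : ∫⁻ ω, F ((A ω, C ω), (B ω, D ω)) ∂Q
      = ∫⁻ p, F ((p.1.1, p.2.1), (p.1.2, p.2.2))
          ∂(((Q.map A).prod (Q.map B)).prod ((Q.map C).prod (Q.map D))) := by
    rw [← mm, lintegral_map (by fun_prop) (by fun_prop)]
  have e2 : ∫⁻ ω, ∫⁻ b, ∫⁻ e, F ((A ω, C ω), (b, e)) ∂(Q.map D) ∂(Q.map B) ∂Q
      = ∫⁻ p, ∫⁻ b, ∫⁻ e, F (p, (b, e)) ∂(Q.map D) ∂(Q.map B) ∂((Q.map A).prod (Q.map C)) := by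
    rw [← mAC, lintegral_map _ (by fun_prop)]
    fun_prop
  rw [e1, e2, lintegral_prod _ (by fun_prop), lintegral_prod _ (by fun_prop),
    lintegral_prod _ (by fun_prop)]
  refine lintegral_congr fun a => ?_
  -- The product law lists the variables as `A, B, C, D`; two Tonelli swaps bring them to the order
  -- `A, C, B, D`.
  rw [lintegral_lintegral_swap (by fun_prop)]
  rw [lintegral_prod _ (by fun_prop)]
  refine lintegral_congr fun c => ?_
  rw [lintegral_lintegral_swap (by fun_prop)]

end Independence

/-! ### The Lyapunov function and its mean change at a jump. -/

/-- The Lyapunov function `f x - f* + b ‖z - x*‖² - c ‖x - x*‖²` of the state `(x, z)`. -/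
noncomputable def lyapunov {d : ℕ} (f : EuclideanSpace ℝ (Fin d) → ℝ)
    (xstar : EuclideanSpace ℝ (Fin d)) (b c : ℝ)
    (p : EuclideanSpace ℝ (Fin d) × EuclideanSpace ℝ (Fin d)) : ℝ :=
  f p.1 - f xstar + b * ‖p.2 - xstar‖ ^ 2 - c * ‖p.1 - xstar‖ ^ 2

/-- The derivative of the Lyapunov function along the flow `x' = η (z - x)`, `z' = η' (x - z)`. -/
noncomputable def lyapunovDrift {d : ℕ} (f : EuclideanSpace ℝ (Fin d) → ℝ)
    (xstar : EuclideanSpace ℝ (Fin d)) (b c η η' : ℝ)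
    (p : EuclideanSpace ℝ (Fin d) × EuclideanSpace ℝ (Fin d)) : ℝ :=
  η * inner ℝ (gradient f p.1) (p.2 - p.1)
    + b * (2 * (η' * inner ℝ (p.2 - xstar) (p.1 - p.2)))
    - c * (2 * (η * inner ℝ (p.1 - xstar) (p.2 - p.1)))

/-- The relations between the step sizes and the coefficients `b`, `c` of the Lyapunov function
under which it decreases at rate `2 η'`. -/
structure LyapunovTuned (τ μ L ρ ε η η' γ γ' b c : ℝ) : Prop where
  eps_nonneg : 0 ≤ ε
  eps_le_one : ε ≤ 1
  eta_pos : 0 < η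
  eta'_pos : 0 < η'
  b_nonneg : 0 ≤ b
  c_nonneg : 0 ≤ c
  coupling : η = 2 * b * γ'
  noise : ρ * (L / 2 * γ ^ 2 + b * γ' ^ 2) ≤ γ
  balance : c * η = b * η'
  c_le : c ≤ (1 - ε) * (τ * μ / (2 * (2 - τ)))
  rate_value : 2 * η' ≤ (η - 2 * c * γ) * τ
  rate_dist : 2 * η' * (b - c) ≤ (η - 2 * c * γ) * τ * (μ / 2)

section

variable {d : ℕ} {f : EuclideanSpace ℝ (Fin d) → ℝ} {xstar : EuclideanSpace ℝ (Fin d)}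
  {L τ μ ρ ε η η' γ γ' b c : ℝ}

lemma le_lyapunov (hf : Differentiable ℝ f) (hsqc : StronglyQuasarConvex f xstar τ μ)
    (ht : LyapunovTuned τ μ L ρ ε η η' γ γ' b c)
    (p : EuclideanSpace ℝ (Fin d) × EuclideanSpace ℝ (Fin d)) :
    ε * (f p.1 - f xstar) ≤ lyapunov f xstar b c p := by
  have h1 := hsqc.quadratic_growth hf p.1
  have h2 : c * ‖p.1 - xstar‖ ^ 2 ≤ (1 - ε) * (f p.1 - f xstar) :=
    calc c * ‖p.1 - xstar‖ ^ 2
        ≤ (1 - ε) * (τ * μ / (2 * (2 - τ))) * ‖p.1 - xstar‖ ^ 2 := by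
          gcongr
          exact ht.c_le
      _ = (1 - ε) * (τ * μ / (2 * (2 - τ)) * ‖p.1 - xstar‖ ^ 2) := by ring
      _ ≤ _ := mul_le_mul_of_nonneg_left h1 (sub_nonneg.2 ht.eps_le_one)
  have h3 : 0 ≤ b * ‖p.2 - xstar‖ ^ 2 := mul_nonneg ht.b_nonneg (by positivity)
  unfold lyapunov
  linarith

lemma lyapunov_nonneg (hf : Differentiable ℝ f) (hsqc : StronglyQuasarConvex f xstar τ μ)
    (ht : LyapunovTuned τ μ L ρ ε η η' γ γ' b c)
    (p : EuclideanSpace ℝ (Fin d) × EuclideanSpace ℝ (Fin d)) :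
    0 ≤ lyapunov f xstar b c p :=
  (mul_nonneg ht.eps_nonneg (sub_nonneg.2 (hsqc.isMin _))).trans (le_lyapunov hf hsqc ht p)

lemma continuous_lyapunov (hf : Differentiable ℝ f) : Continuous (lyapunov f xstar b c) := by
  have := hf.continuous
  unfold lyapunov
  fun_prop

/-- The expected value of the Lyapunov function after a stochastic gradient jump. -/
lemma lintegral_lyapunov_jump_le {Ξ : Type*} [MeasurableSpace Ξ] {P : Measure Ξ}
    [IsProbabilityMeasure P] {g : EuclideanSpace ℝ (Fin d) → Ξ → EuclideanSpace ℝ (Fin d)}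
    (hf : Differentiable ℝ f) (hL : LSmooth f L) (hsqc : StronglyQuasarConvex f xstar τ μ)
    (hsgc : StrongGrowth f P g ρ) (ht : LyapunovTuned τ μ L ρ ε η η' γ γ' b c)
    (x z : EuclideanSpace ℝ (Fin d)) :
    0 ≤ (1 - 2 * η') * lyapunov f xstar b c (x, z) - lyapunovDrift f xstar b c η η' (x, z) ∧
    ∫⁻ s, ENNReal.ofReal (lyapunov f xstar b c (x - γ • g x s, z - γ' • g x s)) ∂P
      ≤ ENNReal.ofReal ((1 - 2 * η') * lyapunov f xstar b c (x, z)
          - lyapunovDrift f xstar b c η η' (x, z)) := by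
  set K : ℝ := L / 2 * γ ^ 2 + b * γ' ^ 2 with hK
  have hK0 : 0 ≤ K := by
    have := hL.pos
    have := ht.b_nonneg
    positivity
  -- `W` is the quadratic upper model of `V` after the jump; `u` collects the coefficients that are
  -- linear in the noise, so its expectation only involves `gradient f x`.
  set u : EuclideanSpace ℝ (Fin d) :=
    -(γ • gradient f x) - (2 * b * γ') • (z - xstar) + (2 * c * γ) • (x - xstar) with hu
  set W : Ξ → ℝ := fun s => lyapunov f xstar b c (x, z) + inner ℝ u (g x s) + K * ‖g x s‖ ^ 2
    with hW
  have hVW : ∀ s, lyapunov f xstar b c (x - γ • g x s, z - γ' • g x s) ≤ W s := by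
    intro s
    have h1 := hL.upper_bound (x - γ • g x s) x
    have e1 : x - γ • g x s - x = -(γ • g x s) := by abel
    rw [e1, norm_neg, inner_neg_right, inner_smul_right, norm_smul, mul_pow, Real.norm_eq_abs,
      sq_abs] at h1
    have e2 : ‖z - γ' • g x s - xstar‖ ^ 2
        = ‖z - xstar‖ ^ 2 - 2 * (γ' * inner ℝ (z - xstar) (g x s)) + γ' ^ 2 * ‖g x s‖ ^ 2 := by
      rw [sub_right_comm, norm_sub_sq_real, inner_smul_right, norm_smul, mul_pow,
        Real.norm_eq_abs, sq_abs]
    have e3 : ‖x - γ • g x s - xstar‖ ^ 2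
        = ‖x - xstar‖ ^ 2 - 2 * (γ * inner ℝ (x - xstar) (g x s)) + γ ^ 2 * ‖g x s‖ ^ 2 := by
      rw [sub_right_comm, norm_sub_sq_real, inner_smul_right, norm_smul, mul_pow,
        Real.norm_eq_abs, sq_abs]
    have e4 : inner ℝ u (g x s) = -(γ * inner ℝ (gradient f x) (g x s))
        - 2 * b * γ' * inner ℝ (z - xstar) (g x s)
        + 2 * c * γ * inner ℝ (x - xstar) (g x s) := by
      rw [hu, inner_add_left, inner_sub_left, inner_neg_left]
      simp only [real_inner_smul_left]
    -- The second-order contribution of the `-c` term has a favourable sign and is dropped.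
    have h5 : 0 ≤ c * (γ ^ 2 * ‖g x s‖ ^ 2) := mul_nonneg ht.c_nonneg (by positivity)
    simp only [hW, lyapunov, e2, e3, e4, hK]
    nlinarith
  have hg1 : Integrable (g x) P := (hsgc.memLp x).integrable (by norm_num)
  have hg2 : Integrable (fun s => ‖g x s‖ ^ 2) P := (hsgc.memLp x).integrable_norm_pow (by norm_num)
  have hi1 : Integrable (fun s => inner ℝ u (g x s)) P := hg1.const_inner u
  have hWi : Integrable W P := ((integrable_const _).add hi1).add (hg2.const_mul K)
  have hWint : ∫ s, W s ∂P = lyapunov f xstar b c (x, z) + inner ℝ u (gradient f x)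
      + K * ∫ s, ‖g x s‖ ^ 2 ∂P := by
    have h1 : ∫ s, inner ℝ u (g x s) ∂P = inner ℝ u (gradient f x) := by
      rw [integral_inner hg1, hsgc.unbiased]
    have h2 : Integrable (fun s => lyapunov f xstar b c (x, z) + inner ℝ u (g x s)) P :=
      (integrable_const _).add hi1
    rw [hW, integral_add h2 (hg2.const_mul K), integral_add (integrable_const _) hi1, h1, integral_const_mul]
    simp
  have hV0 : ∀ s, 0 ≤ W s := fun s => (lyapunov_nonneg hf hsqc ht _).trans (hVW s)
  suffices hfin : ∫ s, W s ∂P ≤ (1 - 2 * η') * lyapunov f xstar b c (x, z)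
      - lyapunovDrift f xstar b c η η' (x, z) from
    ⟨(integral_nonneg hV0).trans hfin,
      calc _ ≤ ∫⁻ s, ENNReal.ofReal (W s) ∂P :=
            lintegral_mono fun s => ENNReal.ofReal_le_ofReal (hVW s)
        _ = ENNReal.ofReal (∫ s, W s ∂P) :=
            (ofReal_integral_eq_lintegral_ofReal hWi (Filter.Eventually.of_forall hV0)).symm
        _ ≤ _ := ENNReal.ofReal_le_ofReal hfin⟩
  rw [hWint]
  have hgr : K * ∫ s, ‖g x s‖ ^ 2 ∂P ≤ γ * ‖gradient f x‖ ^ 2 :=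
    calc K * ∫ s, ‖g x s‖ ^ 2 ∂P ≤ K * (ρ * ‖gradient f x‖ ^ 2) := by
          gcongr
          exact hsgc.growth x
      _ = ρ * K * ‖gradient f x‖ ^ 2 := by ring
      _ ≤ _ := by
          gcongr
          exact ht.noise
  -- `coupling` makes the `z - x` part cancel the gradient term of the drift; `-γ ‖∇f‖²` will absorb
  -- the noise bound `hgr`.
  have e4 : inner ℝ u (gradient f x) = -(γ * ‖gradient f x‖ ^ 2)
      - η * inner ℝ (gradient f x) (z - x)
      - (η - 2 * c * γ) * inner ℝ (gradient f x) (x - xstar) := by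
    have : z - xstar = (z - x) + (x - xstar) := by abel
    rw [hu, inner_add_left, inner_sub_left, inner_neg_left]
    simp only [real_inner_smul_left]
    rw [real_inner_self_eq_norm_sq, this, inner_add_left, ← ht.coupling,
      real_inner_comm (gradient f x), real_inner_comm (gradient f x) (x - xstar)]
    ring
  have e5 : inner ℝ (z - xstar) (x - z)
      = (‖x - xstar‖ ^ 2 - ‖z - xstar‖ ^ 2 - ‖x - z‖ ^ 2) / 2 := by
    have : x - xstar = (z - xstar) + (x - z) := by abel
    rw [this, norm_add_sq_real]
    ring
  have e6 : inner ℝ (x - xstar) (z - x)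
      = (‖z - xstar‖ ^ 2 - ‖x - xstar‖ ^ 2 - ‖x - z‖ ^ 2) / 2 := by
    have : z - xstar = (x - xstar) + (z - x) := by abel
    rw [this, norm_add_sq_real, norm_sub_rev x z]
    ring
  have hB : τ * (f x - f xstar) + τ * (μ / 2) * ‖x - xstar‖ ^ 2
      ≤ inner ℝ (gradient f x) (x - xstar) := by
    have h1 := hsqc.ineq x
    rw [← neg_sub x xstar, inner_neg_right] at h1
    have h2 : f x - f xstar + μ / 2 * ‖x - xstar‖ ^ 2
        ≤ inner ℝ (gradient f x) (x - xstar) / τ := by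
      have : 1 / τ * -inner ℝ (gradient f x) (x - xstar)
        = -(inner ℝ (gradient f x) (x - xstar) / τ) := by ring
      linarith
    rw [le_div_iff₀ hsqc.tau_pos] at h2
    linarith
  have hq : 0 ≤ η - 2 * c * γ :=
    nonneg_of_mul_nonneg_left (by linarith [ht.rate_value, ht.eta'_pos]) hsqc.tau_pos
  have hB' := mul_le_mul_of_nonneg_left hB hq
  have hF := mul_le_mul_of_nonneg_right ht.rate_value (sub_nonneg.2 (hsqc.isMin x))
  have hX := mul_le_mul_of_nonneg_right ht.rate_dist (sq_nonneg ‖x - xstar‖)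
  simp only [lyapunov, lyapunovDrift, e4, e5, e6]
  -- `balance` removes `‖x - z‖²` and leaves exactly `-2 η' b ‖z - x*‖²`; `hF` and `hX` settle the
  -- coefficients of `f x - f*` and `‖x - x*‖²`.
  linear_combination hB' + hF + hX + hgr
    + (-(‖z - xstar‖ ^ 2) + ‖x - xstar‖ ^ 2 + ‖x - z‖ ^ 2) * ht.balance

end

/-! ### The flow over an exponential waiting time. -/

lemma lintegral_expMeasure_one (F : ℝ → ENNReal) :
    ∫⁻ t, F t ∂(expMeasure 1) = ∫⁻ t in Set.Ioi 0, ENNReal.ofReal (Real.exp (-t)) * F t := by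
  rw [expMeasure, gammaMeasure, lintegral_withDensity_eq_lintegral_mul_non_measurable _
    (by unfold gammaPDF; fun_prop) (by simp [gammaPDF]), restrict_Ioi_eq_restrict_Ici,
    ← lintegral_indicator measurableSet_Ici]
  refine lintegral_congr fun t => ?_
  have h := exponentialPDF_eq 1 t
  rw [exponentialPDF, exponentialPDFReal] at h
  rw [Pi.mul_apply, gammaPDF, h, Set.indicator_apply]
  by_cases ht : 0 ≤ t <;> simp [ht]

/-- The end point `z` of the flow started at `(x, z)`, after a time `t`. -/
noncomputable def flowSnd {d : ℕ} (η η' t : ℝ) (x z : EuclideanSpace ℝ (Fin d)) :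
    EuclideanSpace ℝ (Fin d) :=
  (η' / (η + η') * (1 - Real.exp (-(η + η') * t))) • (x - z) + z

section

variable {d : ℕ} {f : EuclideanSpace ℝ (Fin d) → ℝ} {xstar : EuclideanSpace ℝ (Fin d)}
  {L τ μ ρ ε η η' γ γ' b c : ℝ}

/-- The difference `z - x` solves a closed linear equation with decay rate `η + η'`. -/
lemma flowSnd_sub_cnaMid (hη : 0 < η + η') (t : ℝ) (x z : EuclideanSpace ℝ (Fin d)) :
    flowSnd η η' t x z - cnaMid η η' t x z = Real.exp (-(η + η') * t) • (z - x) := by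
  have h : η / (η + η') = 1 - η' / (η + η') := by field_simp; ring
  rw [flowSnd, cnaMid, h]
  module

/-- The algorithm moves `z` along `ỹ - z`, not along `x - z`. The ratio of these two vectors is `(η'
+ η e) / (η + η')`, with `e` the exponential factor, which is exactly what the denominator in the
`z` update compensates. -/
lemma cnaStep_eq_flow {Ξ : Type*} (g : EuclideanSpace ℝ (Fin d) → Ξ → EuclideanSpace ℝ (Fin d))
    (hη : 0 < η) (hη' : 0 < η') (γ γ' t : ℝ) (s : Ξ) (x z : EuclideanSpace ℝ (Fin d)) :
    cnaStep g η η' γ γ' t s (x, z)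
      = (cnaMid η η' t x z - γ • g (cnaMid η η' t x z) s,
        flowSnd η η' t x z - γ' • g (cnaMid η η' t x z) s) := by
  have hy : cnaMid η η' t x z - z
      = ((η' + η * Real.exp (-(η + η') * t)) / (η + η')) • (x - z) := by
    have h : η * (1 - Real.exp (-(η + η') * t)) / (η + η')
        = 1 - (η' + η * Real.exp (-(η + η') * t)) / (η + η') := by field_simp; ring
    rw [cnaMid, div_mul_eq_mul_div, h]
    module
  have hpos : η' + η * Real.exp (-(η + η') * t) ≠ 0 := by positivity
  simp only [cnaStep, Prod.mk.injEq, true_and]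
  rw [hy, smul_smul, flowSnd, add_comm z]
  congr 3
  field_simp

lemma hasDerivAt_flow_coeff (a κ t : ℝ) (hκ : κ ≠ 0) :
    HasDerivAt (fun s : ℝ => a / κ * (1 - Real.exp (-κ * s))) (a * Real.exp (-κ * t)) t := by
  have h := ((((hasDerivAt_id t).const_mul (-κ)).exp).const_sub 1).const_mul (a / κ)
  refine h.congr_deriv ?_
  simp only [id]
  field_simp

lemma hasDerivAt_cnaMid (hη : 0 < η + η') (t : ℝ) (x z : EuclideanSpace ℝ (Fin d)) :
    HasDerivAt (fun s => cnaMid η η' s x z)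
      (η • (flowSnd η η' t x z - cnaMid η η' t x z)) t := by
  rw [flowSnd_sub_cnaMid hη, smul_smul]
  exact ((hasDerivAt_flow_coeff η (η + η') t hη.ne').smul_const (z - x)).add_const x

lemma hasDerivAt_flowSnd (hη : 0 < η + η') (t : ℝ) (x z : EuclideanSpace ℝ (Fin d)) :
    HasDerivAt (fun s => flowSnd η η' s x z)
      (η' • (cnaMid η η' t x z - flowSnd η η' t x z)) t := by
  rw [← neg_sub (flowSnd η η' t x z), flowSnd_sub_cnaMid hη, ← smul_neg, neg_sub, smul_smul]
  exact ((hasDerivAt_flow_coeff η' (η + η') t hη.ne').smul_const (x - z)).add_const z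

lemma hasDerivAt_lyapunov_flow (hf : Differentiable ℝ f) (hη : 0 < η + η') (b c t : ℝ)
    (x z : EuclideanSpace ℝ (Fin d)) :
    HasDerivAt (fun s => lyapunov f xstar b c (cnaMid η η' s x z, flowSnd η η' s x z))
      (lyapunovDrift f xstar b c η η' (cnaMid η η' t x z, flowSnd η η' t x z)) t := by
  have hX := hasDerivAt_cnaMid hη t x z
  have hZ := hasDerivAt_flowSnd hη t x z
  have h := (((hasDerivAt_comp_gradient hf hX).sub_const (f xstar)).add
    (((hZ.sub_const xstar).norm_sq).const_mul b)).sub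
    (((hX.sub_const xstar).norm_sq).const_mul c)
  refine h.congr_deriv ?_
  simp only [lyapunovDrift, inner_smul_right]

/-- In expectation over the exponential waiting time and the sample, one step of the algorithm
does not increase the exponentially weighted Lyapunov function. -/
lemma lintegral_lyapunov_cnaStep_le {Ξ : Type*} [MeasurableSpace Ξ] {P : Measure Ξ}
    [IsProbabilityMeasure P] {g : EuclideanSpace ℝ (Fin d) → Ξ → EuclideanSpace ℝ (Fin d)}
    (hf : Differentiable ℝ f) (hL : LSmooth f L) (hsqc : StronglyQuasarConvex f xstar τ μ)
    (hsgc : StrongGrowth f P g ρ) (ht : LyapunovTuned τ μ L ρ ε η η' γ γ' b c)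
    (p : EuclideanSpace ℝ (Fin d) × EuclideanSpace ℝ (Fin d)) :
    ∫⁻ t, ∫⁻ s, ENNReal.ofReal (Real.exp (2 * η' * t) *
        lyapunov f xstar b c (cnaStep g η η' γ γ' t s p)) ∂P ∂(expMeasure 1)
      ≤ ENNReal.ofReal (lyapunov f xstar b c p) := by
  obtain ⟨x, z⟩ := p
  have hη := ht.eta_pos
  have hη' := ht.eta'_pos
  have hs : 0 < η + η' := by positivity
  set V : ℝ → ℝ := fun t => lyapunov f xstar b c (cnaMid η η' t x z, flowSnd η η' t x z) with hV
  set D : ℝ → ℝ := fun t =>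
    lyapunovDrift f xstar b c η η' (cnaMid η η' t x z, flowSnd η η' t x z) with hD
  -- Density `exp (-t)` times weight `exp (2 η' t)` times the jump bound is the exact derivative of
  -- `H`, so the time integral telescopes. No sign of `1 - 2 η'` is needed: the boundary term is
  -- discarded because `V` is nonnegative.
  set H' : ℝ → ℝ := fun t => Real.exp (-(1 - 2 * η') * t) * ((1 - 2 * η') * V t - D t) with hH'
  set H : ℝ → ℝ := fun t => -(Real.exp (-(1 - 2 * η') * t) * V t) with hH
  have hjump := fun t => lintegral_lyapunov_jump_le hf hL hsqc hsgc ht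
    (cnaMid η η' t x z) (flowSnd η η' t x z)
  have hderiv : ∀ t, HasDerivAt H (H' t) t := by
    intro t
    have h1 : HasDerivAt V (D t) t := hasDerivAt_lyapunov_flow hf hs b c t x z
    have h2 := (((hasDerivAt_id t).const_mul (-(1 - 2 * η'))).exp.mul h1).neg
    refine h2.congr_deriv ?_
    simp only [hH', id]
    ring
  have hH'0 : ∀ t, 0 ≤ H' t := fun t => mul_nonneg (Real.exp_pos _).le (hjump t).1
  have hcont : Continuous H := continuous_iff_continuousAt.2 fun t => (hderiv t).continuousAt
  have hV0 : V 0 = lyapunov f xstar b c (x, z) := by simp [hV, cnaMid, flowSnd]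
  have hN : ∀ N : ℕ, ∫⁻ t in Set.Ioc (0 : ℝ) N, ENNReal.ofReal (H' t)
      ≤ ENNReal.ofReal (lyapunov f xstar b c (x, z)) := by
    intro N
    have hN0 : (0 : ℝ) ≤ N := N.cast_nonneg
    -- The gradient is not assumed continuous; integrability comes from `H'` being a nonnegative
    -- derivative.
    have hint : IntegrableOn H' (Set.Ioc 0 (N : ℝ)) :=
      intervalIntegral.integrableOn_deriv_of_nonneg hcont.continuousOn
        (fun t _ => hderiv t) (fun t _ => hH'0 t)
    rw [← ofReal_integral_eq_lintegral_ofReal hint (Filter.Eventually.of_forall hH'0),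
      ← intervalIntegral.integral_of_le hN0,
      intervalIntegral.integral_eq_sub_of_hasDerivAt_of_le hN0 hcont.continuousOn
        (fun t _ => hderiv t) ((intervalIntegrable_iff_integrableOn_Ioc_of_le hN0).2 hint)]
    refine ENNReal.ofReal_le_ofReal ?_
    have h1 : 0 ≤ V N := lyapunov_nonneg hf hsqc ht _
    have h2 : 0 ≤ Real.exp (-(1 - 2 * η') * N) * V N := mul_nonneg (Real.exp_pos _).le h1
    simp only [hH, mul_zero, Real.exp_zero, one_mul, hV0]
    linarith
  have hU : Set.Ioi (0 : ℝ) = ⋃ N : ℕ, Set.Ioc (0 : ℝ) N := by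
    ext t
    simp only [Set.mem_Ioi, Set.mem_iUnion, Set.mem_Ioc, exists_and_left]
    exact ⟨fun h => ⟨h, exists_nat_ge t⟩, fun h => h.1⟩
  rw [lintegral_expMeasure_one]
  calc _ ≤ ∫⁻ t in Set.Ioi (0 : ℝ), ENNReal.ofReal (H' t) := by
        refine lintegral_mono fun t => ?_
        simp only [cnaStep_eq_flow g hη hη', ENNReal.ofReal_mul (Real.exp_pos _).le, hH']
        rw [lintegral_const_mul' _ _ ENNReal.ofReal_ne_top, ← mul_assoc,
          ← ENNReal.ofReal_mul (Real.exp_pos _).le, ← Real.exp_add]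
        have : -t + 2 * η' * t = -(1 - 2 * η') * t := by ring
        rw [this]
        gcongr
        exact (hjump t).2
    _ ≤ _ := by
        have hdir : Directed (· ⊆ ·) fun N : ℕ => Set.Ioc (0 : ℝ) N :=
          Monotone.directed_le fun M N hMN =>
            Set.Ioc_subset_Ioc_right (Nat.cast_le.2 hMN)
        rw [hU, setLIntegral_iUnion_of_directed _ hdir]
        exact iSup_le hN

end

/-! ### The step sizes satisfy the Lyapunov constraints. -/

/-- In terms of `κ`, `m`, `μ` and `ρ`, the constraints `coupling`, `noise`, `balance` and `c_le`
hold with equality. The two rate constraints have slack: the jump of the `-c` term costs `2 c γ`,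
which is at most `ε ^ 2 * η`, and `1 - ε ≤ 1 - ε ^ 2`. -/
lemma lyapunovTuned_of_parameters {τ μ L ρ ε η η' γ γ' : ℝ} (hτ : 0 < τ) (hτ1 : τ ≤ 1)
    (hμ : 0 < μ) (hL : 0 < L) (hρ : 1 ≤ ρ) (hε₀ : 0 < ε) (hε₁ : ε < 1)
    (hε : (μ / L) ^ (1 / 4 : ℝ) ≤ ε)
    (hη' : η' = (1 - ε) * τ / ρ * √(1 / (2 * (2 - τ))) * √(μ / L))
    (hη : η = 1 / ρ * √(2 / (2 - τ)) * √(μ / L))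
    (hγ' : γ' = 1 / ρ * √((2 - τ) / (2 * μ * L)))
    (hγ : γ = 1 / (ρ * L)) :
    LyapunovTuned τ μ L ρ ε η η' γ γ' (μ / (2 - τ)) ((1 - ε) * τ / 2 * (μ / (2 - τ))) := by
  have h2τ : 0 < 2 - τ := by linarith
  have hρ0 : 0 < ρ := by linarith
  have h1ε : 0 < 1 - ε := by linarith
  set κ : ℝ := √(2 / (2 - τ)) with hκ
  set m : ℝ := √(μ / L) with hm
  have hκ0 : 0 < κ := Real.sqrt_pos.2 (by positivity)
  have hm0 : 0 < m := Real.sqrt_pos.2 (by positivity)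
  have hκ2 : κ ^ 2 = 2 / (2 - τ) := Real.sq_sqrt (by positivity)
  have hm2 : m ^ 2 = μ / L := Real.sq_sqrt (by positivity)
  have e1 : √(1 / (2 * (2 - τ))) = κ / 2 := by
    rw [Real.sqrt_eq_iff_eq_sq (by positivity) (by positivity), div_pow, hκ2]
    field_simp
  have e2 : √((2 - τ) / (2 * μ * L)) = m / (κ * μ) := by
    rw [Real.sqrt_eq_iff_eq_sq (by positivity) (by positivity), div_pow, mul_pow, hκ2, hm2]
    field_simp
  have hb : μ / (2 - τ) = μ * κ ^ 2 / 2 := by rw [hκ2]; field_simp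
  have hLm : L = μ / m ^ 2 := by rw [hm2]; field_simp
  rw [e1] at hη'
  rw [e2] at hγ'
  have hγm : γ = m ^ 2 / (ρ * μ) := by rw [hγ, hLm]; field_simp
  have hη0 : 0 < η := by rw [hη]; positivity
  have hη'η : 2 * η' = (1 - ε) * τ * η := by rw [hη', hη]; ring
  -- This is where the lower bound on `ε` enters.
  have hmε : m ≤ ε ^ 2 := by
    have h0 : 0 ≤ μ / L := by positivity
    have h1 : m = ((μ / L) ^ (1 / 4 : ℝ)) ^ 2 := by
      rw [hm, Real.sqrt_eq_rpow, ← Real.rpow_natCast, ← Real.rpow_mul h0]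
      norm_num
    rw [h1]
    gcongr
  have hκle : κ ≤ 2 := by
    rw [hκ, Real.sqrt_le_left (by norm_num), div_le_iff₀ h2τ]
    linarith
  set c : ℝ := (1 - ε) * τ / 2 * (μ / (2 - τ)) with hc
  have hcγ : 2 * c * γ ≤ ε ^ 2 * η := by
    have h1 : 2 * c * γ = ((1 - ε) * τ * (κ / 2) * m) * η := by
      rw [hc, hb, hγm, hη]
      field_simp
    rw [h1]
    have h2 : (1 - ε) * τ * (κ / 2) ≤ 1 := by
      have h3 : (1 - ε) * τ ≤ 1 := mul_le_one₀ (by linarith) hτ.le hτ1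
      exact mul_le_one₀ h3 (by positivity) (by linarith)
    gcongr
    calc (1 - ε) * τ * (κ / 2) * m ≤ 1 * m := by gcongr
      _ ≤ ε ^ 2 := by rwa [one_mul]
  have hq : (1 - ε ^ 2) * η ≤ η - 2 * c * γ := by linarith
  refine ⟨hε₀.le, hε₁.le, hη0, ?_, by positivity, by positivity, ?_, ?_, ?_, ?_, ?_, ?_⟩
  · rw [hη']; positivity
  · rw [hη, hγ', hb]; field_simp
  · refine le_of_eq ?_
    rw [hγ', hγm, hb, hLm]
    field_simp
    norm_num
  · rw [hc]
    linear_combination (-(μ / (2 - τ)) / 2) * hη'η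
  · refine le_of_eq ?_
    rw [hc]
    field_simp
  · rw [hη'η]
    have h1 : (1 - ε) * η ≤ (1 - ε ^ 2) * η := by
      gcongr
      nlinarith
    nlinarith
  · have h1 : (1 - ε) * (μ / (2 - τ) - c) ≤ (1 - ε ^ 2) * (μ / 2) := by
      have h2 : (1 - ε ^ 2) * (μ / 2) - (1 - ε) * (μ / (2 - τ) - c)
          = (1 - ε) * ε * μ * (1 - τ) / (2 - τ) := by
        rw [hc]
        field_simp
        ring
      have h3 : 0 ≤ (1 - ε) * ε * μ * (1 - τ) / (2 - τ) := by
        have : 0 ≤ 1 - τ := by linarith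
        positivity
      linarith
    calc 2 * η' * (μ / (2 - τ) - c) = (1 - ε) * (μ / (2 - τ) - c) * (τ * η) := by
          rw [hη'η]; ring
      _ ≤ (1 - ε ^ 2) * (μ / 2) * (τ * η) := by gcongr
      _ = (1 - ε ^ 2) * η * τ * (μ / 2) := by ring
      _ ≤ _ := by gcongr

/-! ### Measurability of the iterates. -/

section

variable {d : ℕ} {Ξ : Type*} [MeasurableSpace Ξ]
  {g : EuclideanSpace ℝ (Fin d) → Ξ → EuclideanSpace ℝ (Fin d)}

lemma measurable_cnaStep {α : Type*} [MeasurableSpace α]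
    (hg : Measurable fun p : EuclideanSpace ℝ (Fin d) × Ξ => g p.1 p.2) (η η' γ γ' : ℝ)
    {δ : α → ℝ} {s : α → Ξ} {p : α → EuclideanSpace ℝ (Fin d) × EuclideanSpace ℝ (Fin d)}
    (hδ : Measurable δ) (hs : Measurable s) (hp : Measurable p) :
    Measurable fun a => cnaStep g η η' γ γ' (δ a) (s a) (p a) := by
  have hmid : Measurable fun a => cnaMid η η' (δ a) (p a).1 (p a).2 := by
    unfold cnaMid
    fun_prop
  have hgm : Measurable fun a => g (cnaMid η η' (δ a) (p a).1 (p a).2) (s a) :=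
    hg.comp (hmid.prodMk hs)
  unfold cnaStep
  fun_prop

/-- The time and the iterate of index `k` are a measurable function of the first `k` increments
and the first `k` samples. -/
lemma exists_measurable_cnaIter
    (hg : Measurable fun p : EuclideanSpace ℝ (Fin d) × Ξ => g p.1 p.2) (η η' γ γ' : ℝ)
    (x₀ : EuclideanSpace ℝ (Fin d)) (k : ℕ) :
    ∃ Φ : (Finset.range k → ℝ) × (Finset.range k → Ξ) →
        ℝ × (EuclideanSpace ℝ (Fin d) × EuclideanSpace ℝ (Fin d)),
      Measurable Φ ∧ ∀ (t : ℕ → ℝ) (s : ℕ → Ξ), t 0 = 0 →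
        Φ (fun i => t (i + 1) - t i, fun i => s (i + 1))
          = (t k, cnaIter g η η' γ γ' x₀ t s k) := by
  induction k with
  | zero => exact ⟨fun _ => (0, (x₀, x₀)), measurable_const, fun t s ht => by simp [cnaIter, ht]⟩
  | succ k ih =>
    obtain ⟨Φ, hΦ, hΦe⟩ := ih
    obtain ⟨ι, hι⟩ : ∃ ι : Finset.range k → Finset.range (k + 1), ∀ i, (ι i : ℕ) = i :=
      ⟨fun i => ⟨i, Finset.range_subset_range.2 k.le_succ i.2⟩, fun _ => rfl⟩
    obtain ⟨l, hl_eq⟩ : ∃ l : Finset.range (k + 1), (l : ℕ) = k :=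
      ⟨⟨k, Finset.self_mem_range_succ k⟩, rfl⟩
    have hR : Measurable fun q : (Finset.range (k + 1) → ℝ) × (Finset.range (k + 1) → Ξ) =>
        Φ (fun i => q.1 (ι i), fun i => q.2 (ι i)) :=
      hΦ.comp ((measurable_pi_lambda _ fun i => (measurable_pi_apply (ι i)).comp measurable_fst).prodMk
        (measurable_pi_lambda _ fun i => (measurable_pi_apply (ι i)).comp measurable_snd))
    have hl : Measurable fun q : (Finset.range (k + 1) → ℝ) × (Finset.range (k + 1) → Ξ) =>
        (q.1 l, q.2 l) :=
      ((measurable_pi_apply l).comp measurable_fst).prodMk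
        ((measurable_pi_apply l).comp measurable_snd)
    have hS : Measurable fun q : (Finset.range (k + 1) → ℝ) × (Finset.range (k + 1) → Ξ) =>
        cnaStep g η η' γ γ' (q.1 l) (q.2 l) (Φ (fun i => q.1 (ι i), fun i => q.2 (ι i))).2 :=
      measurable_cnaStep hg η η' γ γ' hl.fst hl.snd hR.snd
    -- The time is rebuilt as a sum of increments, which is why `t 0 = 0` is required.
    refine ⟨fun q => ((Φ (fun i => q.1 (ι i), fun i => q.2 (ι i))).1 + q.1 l,
      cnaStep g η η' γ γ' (q.1 l) (q.2 l) (Φ (fun i => q.1 (ι i), fun i => q.2 (ι i))).2),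
      (hR.fst.add hl.fst).prodMk hS, ?_⟩
    · intro t s ht
      have h := hΦe t s ht
      simp only [hι, hl_eq, h]
      simp [cnaIter]

end

/-! ### Decay in expectation along the iteration. -/

section

variable {d : ℕ} {Ω Ξ : Type*} [MeasurableSpace Ω] [MeasurableSpace Ξ]
  {Q : Measure Ω} {P : Measure Ξ}
  {f : EuclideanSpace ℝ (Fin d) → ℝ} {xstar : EuclideanSpace ℝ (Fin d)}
  {g : EuclideanSpace ℝ (Fin d) → Ξ → EuclideanSpace ℝ (Fin d)}
  {T : ℕ → Ω → ℝ} {ξ : ℕ → Ω → Ξ} {L τ μ ρ ε η η' γ γ' b c : ℝ}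

lemma measurable_time_cnaIter (hg : Measurable fun p : EuclideanSpace ℝ (Fin d) × Ξ => g p.1 p.2)
    (hTξ : IsDriving Q P T ξ) (η η' γ γ' : ℝ) (x₀ : EuclideanSpace ℝ (Fin d)) (k : ℕ) :
    Measurable fun ω =>
      (T k ω, cnaIter g η η' γ γ' x₀ (fun i => T i ω) (fun i => ξ i ω) k) := by
  obtain ⟨Φ, hΦ, hΦe⟩ := exists_measurable_cnaIter hg η η' γ γ' x₀ k
  have hA : Measurable fun ω (i : Finset.range k) => T (i + 1) ω - T i ω :=
    measurable_pi_lambda _ fun i => (hTξ.measurable_time _).sub (hTξ.measurable_time _)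
  have hC : Measurable fun ω (i : Finset.range k) => ξ (i + 1) ω :=
    measurable_pi_lambda _ fun i => hTξ.measurable_sample _
  convert hΦ.comp (hA.prodMk hC) using 1
  ext1 ω
  exact Eq.symm <| hΦe (fun i => T i ω) (fun i => ξ i ω) (hTξ.time_zero ω)

lemma lintegral_lyapunov_cnaIter_le [IsProbabilityMeasure Q] [IsProbabilityMeasure P]
    (hf : Differentiable ℝ f) (hL : LSmooth f L)
    (hsqc : StronglyQuasarConvex f xstar τ μ) (hsgc : StrongGrowth f P g ρ)
    (ht : LyapunovTuned τ μ L ρ ε η η' γ γ' b c) (hTξ : IsDriving Q P T ξ)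
    (x₀ : EuclideanSpace ℝ (Fin d)) (k : ℕ) :
    ∫⁻ ω, ENNReal.ofReal (Real.exp (2 * η' * T k ω) * lyapunov f xstar b c
        (cnaIter g η η' γ γ' x₀ (fun i => T i ω) (fun i => ξ i ω) k)) ∂Q
      ≤ ENNReal.ofReal (lyapunov f xstar b c (x₀, x₀)) := by
  induction k with
  | zero => simp [cnaIter, hTξ.time_zero]
  | succ k ih =>
    obtain ⟨Φ, hΦ, hΦe⟩ := exists_measurable_cnaIter hsgc.measurable η η' γ γ' x₀ k
    have hΔ : ∀ i, Measurable fun ω => T (i + 1) ω - T i ω := fun i =>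
      (hTξ.measurable_time _).sub (hTξ.measurable_time _)
    have hA : Measurable fun ω (i : Finset.range k) => T (i + 1) ω - T i ω :=
      measurable_pi_lambda _ fun i => hΔ i
    have hC : Measurable fun ω (i : Finset.range k) => ξ (i + 1) ω :=
      measurable_pi_lambda _ fun i => hTξ.measurable_sample _
    have hdisj : Disjoint (Finset.range k) {k} := by simp
    have hAB : IndepFun (fun ω (i : Finset.range k) => T (i + 1) ω - T i ω)
        (fun ω => T (k + 1) ω - T k ω) Q :=
      (hTξ.indep_increment.indepFun_finset (Finset.range k) {k} hdisj hΔ).comp measurable_id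
        (measurable_pi_apply (⟨k, Finset.mem_singleton_self k⟩ : ({k} : Finset ℕ)))
    have hCD : IndepFun (fun ω (i : Finset.range k) => ξ (i + 1) ω) (fun ω => ξ (k + 1) ω) Q :=
      (hTξ.indep_sample.indepFun_finset (Finset.range k) {k} hdisj hTξ.measurable_sample).comp
        measurable_id
        (measurable_pi_apply (⟨k, Finset.mem_singleton_self k⟩ : ({k} : Finset ℕ)))
    have hABCD : IndepFun
        (fun ω => ((fun i : Finset.range k => T (i + 1) ω - T i ω), T (k + 1) ω - T k ω))
        (fun ω => ((fun i : Finset.range k => ξ (i + 1) ω), ξ (k + 1) ω)) Q :=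
      hTξ.indep.comp (φ := fun v : ℕ → ℝ => ((fun i : Finset.range k => v i), v k))
        (ψ := fun v : ℕ → Ξ => ((fun i : Finset.range k => v i), v k)) (by fun_prop) (by fun_prop)
    -- The past enters only through `Φ`, so that the newest pair can be integrated against
    -- `expMeasure 1` and `P` with the past frozen.
    set F : ((Finset.range k → ℝ) × (Finset.range k → Ξ)) × (ℝ × Ξ) → ENNReal := fun q =>
      ENNReal.ofReal (Real.exp (2 * η' * ((Φ q.1).1 + q.2.1)) *
        lyapunov f xstar b c (cnaStep g η η' γ γ' q.2.1 q.2.2 (Φ q.1).2)) with hF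
    have hFm : Measurable F := by
      have h1 : Measurable fun q : ((Finset.range k → ℝ) × (Finset.range k → Ξ)) × (ℝ × Ξ) =>
          Φ q.1 := hΦ.comp measurable_fst
      have h2 : Measurable fun q : ((Finset.range k → ℝ) × (Finset.range k → Ξ)) × (ℝ × Ξ) =>
          cnaStep g η η' γ γ' q.2.1 q.2.2 (Φ q.1).2 :=
        measurable_cnaStep hsgc.measurable η η' γ γ' measurable_snd.fst measurable_snd.snd h1.snd
      have h3 := (continuous_lyapunov (xstar := xstar) (b := b) (c := c) hf).measurable.comp h2
      exact (((h1.fst.add (by fun_prop)).const_mul _).exp.mul h3).ennreal_ofReal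
    have key := lintegral_of_indepFun_prod hA (hΔ k) hC (hTξ.measurable_sample k) hAB hCD hABCD hFm
    rw [hTξ.law_increment, hTξ.law_sample] at key
    calc _ = ∫⁻ ω, F ((fun i => T (i + 1) ω - T i ω, fun i => ξ (i + 1) ω),
            (T (k + 1) ω - T k ω, ξ (k + 1) ω)) ∂Q := by
          refine lintegral_congr fun ω => ?_
          simp only [hF, hΦe (fun i => T i ω) (fun i => ξ i ω) (hTξ.time_zero ω)]
          rw [add_sub_cancel, cnaIter]
      _ ≤ ∫⁻ ω, ENNReal.ofReal (Real.exp (2 * η' * T k ω) * lyapunov f xstar b c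
            (cnaIter g η η' γ γ' x₀ (fun i => T i ω) (fun i => ξ i ω) k)) ∂Q := by
          rw [key]
          refine lintegral_mono fun ω => ?_
          simp only [hF, hΦe (fun i => T i ω) (fun i => ξ i ω) (hTξ.time_zero ω), mul_add,
            Real.exp_add, mul_assoc, ENNReal.ofReal_mul (Real.exp_pos (2 * (η' * T k ω))).le]
          simp only [lintegral_const_mul' _ _ ENNReal.ofReal_ne_top]
          gcongr
          simpa only [mul_assoc] using lintegral_lyapunov_cnaStep_le hf hL hsqc hsgc ht
            (cnaIter g η η' γ γ' x₀ (fun i => T i ω) (fun i => ξ i ω) k)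
      _ ≤ _ := ih

end

/-! ### The convergence bound. -/

theorem theorem4 {d : ℕ} {Ω Ξ : Type*} [MeasurableSpace Ω] [MeasurableSpace Ξ]
    (Q : Measure Ω) [IsProbabilityMeasure Q] (P : Measure Ξ) [IsProbabilityMeasure P]
    (f : EuclideanSpace ℝ (Fin d) → ℝ) (hf : Differentiable ℝ f)
    (xstar : EuclideanSpace ℝ (Fin d)) (L τ μ ρ : ℝ)
    (hL : LSmooth f L) (hsqc : StronglyQuasarConvex f xstar τ μ)
    (g : EuclideanSpace ℝ (Fin d) → Ξ → EuclideanSpace ℝ (Fin d))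
    (hsgc : StrongGrowth f P g ρ)
    (T : ℕ → Ω → ℝ) (ξ : ℕ → Ω → Ξ) (hTξ : IsDriving Q P T ξ)
    (x₀ : EuclideanSpace ℝ (Fin d))
    (ε : ℝ) (hε₀ : 0 < ε) (hε₁ : ε < 1) (hε : (μ / L) ^ (1 / 4 : ℝ) ≤ ε)
    (η η' γ γ' : ℝ)
    (hη' : η' = (1 - ε) * τ / ρ * √(1 / (2 * (2 - τ))) * √(μ / L))
    (hη : η = 1 / ρ * √(2 / (2 - τ)) * √(μ / L))
    (hγ' : γ' = 1 / ρ * √((2 - τ) / (2 * μ * L)))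
    (hγ : γ = 1 / (ρ * L)) :
    (∀ k : ℕ,
      Integrable (fun ω => Real.exp (cnaRate τ μ L ρ ε * T k ω) *
        (f (cnaIter g η η' γ γ' x₀ (fun i => T i ω) (fun i => ξ i ω) k).1 - f xstar)) Q ∧
      ∫ ω, Real.exp (cnaRate τ μ L ρ ε * T k ω) *
        (f (cnaIter g η η' γ γ' x₀ (fun i => T i ω) (fun i => ξ i ω) k).1 - f xstar) ∂Q
        ≤ 1 / ε * (f x₀ - f xstar + μ * ‖x₀ - xstar‖ ^ 2)) ∧
    (τ = 1 → ρ = 1 → cnaRate τ μ L ρ ε = √2 * (1 - ε) * (τ * √(μ / L))) := by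
  have ht := lyapunovTuned_of_parameters hsqc.tau_pos hsqc.tau_le_one hsqc.mu_pos hL.pos
    hsgc.one_le_rho hε₀ hε₁ hε hη' hη hγ' hγ
  have h2τ : 0 < 2 - τ := by linarith [hsqc.tau_le_one]
  have hμ := hsqc.mu_pos
  have hrate : cnaRate τ μ L ρ ε = 2 * η' := by
    have h1 : √(2 / (2 - τ)) = 2 * √(1 / (2 * (2 - τ))) := by
      have : 2 / (2 - τ) = 2 ^ 2 * (1 / (2 * (2 - τ))) := by field_simp
      rw [this, Real.sqrt_mul (by norm_num), Real.sqrt_sq (by norm_num)]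
    rw [cnaRate, hη', h1]
    ring
  refine ⟨fun k => ?_, ?_⟩
  · set S : Ω → EuclideanSpace ℝ (Fin d) × EuclideanSpace ℝ (Fin d) := fun ω =>
      cnaIter g η η' γ γ' x₀ (fun i => T i ω) (fun i => ξ i ω) k with hS
    set V₀ : ℝ := lyapunov f xstar (μ / (2 - τ)) ((1 - ε) * τ / 2 * (μ / (2 - τ))) (x₀, x₀)
      with hV₀
    have hSm : Measurable S :=
      (measurable_time_cnaIter hsgc.measurable hTξ η η' γ γ' x₀ k).snd
    set G : Ω → ℝ := fun ω => Real.exp (cnaRate τ μ L ρ ε * T k ω) * (f (S ω).1 - f xstar)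
      with hG
    have hGm : Measurable G :=
      ((hTξ.measurable_time k).const_mul _).exp.mul
        ((hf.continuous.measurable.comp hSm.fst).sub_const _)
    have hG0 : ∀ ω, 0 ≤ G ω := fun ω =>
      mul_nonneg (Real.exp_pos _).le (sub_nonneg.2 (hsqc.isMin _))
    have hle : ∫⁻ ω, ENNReal.ofReal (G ω) ∂Q ≤ ENNReal.ofReal (1 / ε * V₀) := by
      rw [ENNReal.ofReal_mul (by positivity)]
      calc ∫⁻ ω, ENNReal.ofReal (G ω) ∂Q
          ≤ ∫⁻ ω, ENNReal.ofReal (1 / ε) * ENNReal.ofReal (Real.exp (2 * η' * T k ω) *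
              lyapunov f xstar (μ / (2 - τ)) ((1 - ε) * τ / 2 * (μ / (2 - τ))) (S ω)) ∂Q := by
            refine lintegral_mono fun ω => ?_
            rw [← ENNReal.ofReal_mul (by positivity)]
            refine ENNReal.ofReal_le_ofReal ?_
            have h1 := le_lyapunov hf hsqc ht (S ω)
            have h2 : f (S ω).1 - f xstar ≤ 1 / ε *
                lyapunov f xstar (μ / (2 - τ)) ((1 - ε) * τ / 2 * (μ / (2 - τ))) (S ω) := by
              rw [one_div, ← div_eq_inv_mul, le_div_iff₀' hε₀]
              exact h1
            simp only [hG, hrate]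
            rw [mul_left_comm]
            gcongr
        _ = ENNReal.ofReal (1 / ε) * ∫⁻ ω, ENNReal.ofReal (Real.exp (2 * η' * T k ω) *
              lyapunov f xstar (μ / (2 - τ)) ((1 - ε) * τ / 2 * (μ / (2 - τ))) (S ω)) ∂Q :=
            lintegral_const_mul' _ _ ENNReal.ofReal_ne_top
        _ ≤ _ := by
            gcongr
            exact lintegral_lyapunov_cnaIter_le hf hL hsqc hsgc ht hTξ x₀ k
    have hGi : Integrable G Q := by
      refine ⟨hGm.aestronglyMeasurable, ?_⟩
      rw [hasFiniteIntegral_iff_ofReal (Filter.Eventually.of_forall hG0)]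
      exact hle.trans_lt ENNReal.ofReal_lt_top
    have hV₀0 : 0 ≤ V₀ := lyapunov_nonneg hf hsqc ht _
    refine ⟨hGi, ?_⟩
    have h1 : ∫ ω, G ω ∂Q ≤ 1 / ε * V₀ := by
      rw [← ofReal_integral_eq_lintegral_ofReal hGi (Filter.Eventually.of_forall hG0)] at hle
      exact (ENNReal.ofReal_le_ofReal_iff (by positivity)).1 hle
    refine h1.trans ?_
    gcongr
    -- At the start `z = x = x₀`: the `-c` term is dropped, and `b ≤ μ` because `τ ≤ 1`.
    have hb : μ / (2 - τ) ≤ μ := div_le_self hμ.le (by linarith [hsqc.tau_le_one])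
    have h2 := mul_le_mul_of_nonneg_right hb (sq_nonneg ‖x₀ - xstar‖)
    have h3 := mul_nonneg ht.c_nonneg (sq_nonneg ‖x₀ - xstar‖)
    simp only [hV₀, lyapunov]
    linarith
  · rintro rfl rfl
    have h : (2 : ℝ) / (2 - 1) = 2 := by norm_num
    rw [cnaRate, h]
    ring
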